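/- Let $K$ be an algebraically closed field, $S=K[y_0,\dots,y_n]$ with its standard grading, and $\mathfrak M=(y_0,\dots,y_n)$ the irrelevant ideal. A homogeneous ideal $\mathfrak J\subseteq S$ is *saturated* if $f\in\mathfrak J$ whenever $f\,\mathfrak M^t\subseteq\mathfrak J$ for some $t\in\mathbb N$; the *saturation* $\mathfrak J^{sat}$ of a homogeneous ideal $\mathfrak J$ is the smallest saturated ideal containing $\mathfrak J$. A *standard basis* of a homogeneous ideal $\mathfrak I$ is a finite ordered system $\mathcal B=(f_1,\dots,f_m)$ of forms generating $\mathfrak I$ such that for every $d$ the classes of the members of degree $d$ form a $K$-basis of $\mathfrak I_d/(\mathfrak I_{d-1}S_1)$. The member $f_r$ is *inessential* with respect to $\mathcal B$ if $f_r\in\mathfrak H^{sat}$, where $\mathfrak H$ is the ideal generated by $\mathcal B\setminus\{f_r\}$. Let $\mathfrak I\subseteq S$ be a homogeneous ideal that is perfect (the projective dimension of the $S$-module $S/\mathfrak I$ equals the grade of $\mathfrak I$) of height $2$. Let $\mathcal B=(f_1,\dots,f_m)$ be a standard basis of $\mathfrak I$, and let $M=(a_{ij})$, $1\le i\le m-1$,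 $1\le j\le m$, be a Hilbert–Burch matrix of $\mathfrak I$ with respect to $\mathcal B$, that is, a matrix over $S$ whose rows form a basis of the $S$-module of syzygies $\{(c_1,\dots,c_m)\in S^m:\sum_j c_jf_j=0\}$ and are homogeneous, meaning that for each $i$ there is an $e_i$ such that every product $a_{ij}f_j$ is zero or a form of degree $e_i$. For $1\le r\le m$ let $\mathfrak I_{C_r}\subseteq S$ be the ideal generated by the entries $a_{1r},\dots,a_{m-1,r}$ of the $r$-th column of $M$. Then $f_r$ is inessential with respect to $\mathcal B$ if and only if there exists $t\in\mathbb N$ with $\mathfrak M^t\subseteq\mathfrak I_{C_r}$. -/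

import Mathlib

open MvPolynomial

noncomputable section

namespace HilbertBurch

universe u

attribute [local instance] MvPolynomial.gradedAlgebra

/-- The grade of an ideal: the supremum of the lengths of the `R`-regular sequences contained
in it. -/
def grade {R : Type u} [CommRing R] (I : Ideal R) : ℕ∞ :=
  ⨆ (rs : List R) (_ : (∀ r ∈ rs, r ∈ I) ∧ RingTheory.Sequence.IsRegular R rs), (rs.length : ℕ∞)

/-- An ideal `I` of `R` is perfect if the projective dimension of the `R`-module `R ⧸ I` equals
the grade of `I`. (The unit ideal is not perfect: the zero module has projective dimension `⊥`.) -/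
def IsPerfect {R : Type u} [CommRing R] (I : Ideal R) : Prop :=
  CategoryTheory.projectiveDimension (ModuleCat.of.{u} R (R ⧸ I)) = ((grade I : ℕ∞) : WithBot ℕ∞)

variable {K : Type u} [Field K] {n : ℕ}

/-- The irrelevant ideal `(y₀, …, yₙ)` of `K[y₀, …, yₙ]`. -/
def irrelevantIdeal (K : Type u) [Field K] (n : ℕ) : Ideal (MvPolynomial (Fin (n + 1)) K) :=
  Ideal.span (Set.range X)

/-- A homogeneous ideal: it contains the homogeneous components of its elements. -/
abbrev IsHomogeneousIdeal (I : Ideal (MvPolynomial (Fin (n + 1)) K)) : Prop :=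
  I.IsHomogeneous (homogeneousSubmodule (Fin (n + 1)) K)

/-- A homogeneous ideal `I` is saturated if `f 𝔐 ^ t ⊆ I` for some `t` implies `f ∈ I`. -/
def IsSaturated (I : Ideal (MvPolynomial (Fin (n + 1)) K)) : Prop :=
  IsHomogeneousIdeal I ∧
    ∀ f, (∃ t : ℕ, ∀ p ∈ irrelevantIdeal K n ^ t, f * p ∈ I) → f ∈ I

/-- The saturation of `I`: the smallest saturated ideal containing `I`. -/
def saturation (I : Ideal (MvPolynomial (Fin (n + 1)) K)) :
    Ideal (MvPolynomial (Fin (n + 1)) K) :=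
  sInf {J | IsSaturated J ∧ I ≤ J}

/-- The `K`-vector space `I_d` of the forms of degree `d` in `I`. -/
def degreePart (I : Ideal (MvPolynomial (Fin (n + 1)) K)) (d : ℕ) :
    Submodule K (MvPolynomial (Fin (n + 1)) K) :=
  I.restrictScalars K ⊓ homogeneousSubmodule (Fin (n + 1)) K d

/-- The `K`-vector space `I_{d-1} S₁` (which is zero for `d = 0`). -/
def lowerPart (I : Ideal (MvPolynomial (Fin (n + 1)) K)) :
    ℕ → Submodule K (MvPolynomial (Fin (n + 1)) K)
  | 0 => ⊥
  | d + 1 => degreePart I d * homogeneousSubmodule (Fin (n + 1)) K 1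

/-- `g` is a standard basis of `I`: its members are forms, they generate `I`, and for every `d`
the classes of those of degree `d` are a `K`-basis of `I_d / (I_{d-1} S₁)`. -/
structure IsStandardBasis (I : Ideal (MvPolynomial (Fin (n + 1)) K)) {t : ℕ}
    (g : Fin t → MvPolynomial (Fin (n + 1)) K) : Prop where
  isForm : ∀ j, (g j).IsHomogeneous (g j).totalDegree
  span_eq : Ideal.span (Set.range g) = I
  basis : ∀ d : ℕ,
    ∃ b : Module.Basis {j : Fin t // (g j).totalDegree = d} K
        (degreePart I d ⧸ (lowerPart I d).submoduleOf (degreePart I d)),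
      ∀ j : {j : Fin t // (g j).totalDegree = d},
        ∃ h : g j.1 ∈ degreePart I d, b j = Submodule.Quotient.mk ⟨g j.1, h⟩

/-- The member `g r` of the basis `g` is inessential with respect to `g`: it lies in the
saturation of the ideal generated by the other members. -/
def IsInessential {t : ℕ} (g : Fin t → MvPolynomial (Fin (n + 1)) K) (r : Fin t) : Prop :=
  g r ∈ saturation (Ideal.span (Set.range g \ {g r}))

/-- `A` is a Hilbert–Burch matrix with respect to `g`: its rows are a basis of the module
of syzygies of `g`, and each row is a homogeneous syzygy, i.e. the products `A i j * g j`
all have one degree. (No ordering of the degrees of the rows or of the members of `g` is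
imposed.) -/
structure IsHilbertBurchMatrix {m : ℕ} (g : Fin (m + 1) → MvPolynomial (Fin (n + 1)) K)
    (A : Matrix (Fin m) (Fin (m + 1)) (MvPolynomial (Fin (n + 1)) K)) : Prop where
  linearIndependent : LinearIndependent (MvPolynomial (Fin (n + 1)) K) A.row
  span_eq : Submodule.span (MvPolynomial (Fin (n + 1)) K) (Set.range A.row) =
    LinearMap.ker (Fintype.linearCombination (MvPolynomial (Fin (n + 1)) K) g)
  homogeneous : ∀ i, ∃ e : ℕ, ∀ j, (A i j * g j).IsHomogeneous e

/-- The ideal generated by the entries of the column `r` of `A`. -/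
def columnIdeal {m : ℕ} (A : Matrix (Fin m) (Fin (m + 1)) (MvPolynomial (Fin (n + 1)) K))
    (r : Fin (m + 1)) : Ideal (MvPolynomial (Fin (n + 1)) K) :=
  Ideal.span (Set.range fun i => A i r)

end HilbertBurch

end

namespace HilbertBurch

attribute [local instance] MvPolynomial.gradedAlgebra

/-! Let `H` be the ideal generated by the members other than `g r`. As `H` is homogeneous, its
saturation consists of the `f` with `f 𝔐 ^ t ⊆ H` for some `t` (`saturation_eq_irrelevantTorsion`),
so `g r` is inessential iff some `𝔐 ^ t` lies in the colon ideal `H : g r`. A multiple `p * g r`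
lies in `H` exactly when `p` is the `r`-th coordinate of a syzygy; as the rows of `A` generate the
syzygies, `H : g r` is the column ideal (`mem_columnIdeal_iff`). -/

/-- The ideal of the elements `f` with `f 𝔐 ^ t ⊆ I` for some `t`. -/
def irrelevantTorsion {K : Type*} [Field K] {n : ℕ} (I : Ideal (MvPolynomial (Fin (n + 1)) K)) :
    Ideal (MvPolynomial (Fin (n + 1)) K) where
  carrier := {f | ∃ t : ℕ, ∀ p ∈ irrelevantIdeal K n ^ t, f * p ∈ I}
  zero_mem' := ⟨0, fun p _ => by simp⟩
  add_mem' := by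
    rintro a b ⟨s, hs⟩ ⟨t, ht⟩
    refine ⟨max s t, fun p hp => ?_⟩
    rw [add_mul]
    exact I.add_mem (hs p (Ideal.pow_le_pow_right (le_max_left s t) hp))
      (ht p (Ideal.pow_le_pow_right (le_max_right s t) hp))
  smul_mem' := by
    rintro c a ⟨s, hs⟩
    refine ⟨s, fun p hp => ?_⟩
    rw [smul_eq_mul, mul_assoc]
    exact I.mul_mem_left c (hs p hp)

variable {K : Type*} [Field K] {n : ℕ}

theorem mem_irrelevantTorsion {I : Ideal (MvPolynomial (Fin (n + 1)) K)}
    {f : MvPolynomial (Fin (n + 1)) K} :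
    f ∈ irrelevantTorsion I ↔ ∃ t : ℕ, ∀ p ∈ irrelevantIdeal K n ^ t, f * p ∈ I :=
  Iff.rfl

theorem le_irrelevantTorsion (I : Ideal (MvPolynomial (Fin (n + 1)) K)) :
    I ≤ irrelevantTorsion I :=
  fun _ hf => ⟨0, fun p _ => I.mul_mem_right p hf⟩

theorem isHomogeneousIdeal_irrelevantIdeal_pow (t : ℕ) :
    IsHomogeneousIdeal (irrelevantIdeal K n ^ t) := by
  induction t with
  | zero => simpa using Ideal.IsHomogeneous.top (homogeneousSubmodule (Fin (n + 1)) K)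
  | succ t ih =>
    rw [pow_succ]
    refine ih.mul (Ideal.homogeneous_span _ _ ?_)
    rintro _ ⟨i, rfl⟩
    exact ⟨1, isHomogeneous_X K i⟩

theorem isHomogeneousIdeal_irrelevantTorsion {I : Ideal (MvPolynomial (Fin (n + 1)) K)}
    (hI : IsHomogeneousIdeal I) : IsHomogeneousIdeal (irrelevantTorsion I) := by
  classical
  rintro i f ⟨t, ht⟩
  refine ⟨t, fun p hp => ?_⟩
  rw [← DirectSum.sum_support_decompose (homogeneousSubmodule (Fin (n + 1)) K) p, Finset.mul_sum]
  refine I.sum_mem fun k _ => ?_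
  -- For `p` split into its components `p_k`, `f_i * p_k` is the component of degree `i + k` of `f *
  -- p_k`, and `p_k` is again in `𝔐 ^ t`.
  rw [← DirectSum.coe_decompose_mul_add_of_right_mem (homogeneousSubmodule (Fin (n + 1)) K)
    (SetLike.coe_mem _)]
  exact hI _ (ht _ (isHomogeneousIdeal_irrelevantIdeal_pow t k hp))

theorem isSaturated_irrelevantTorsion {I : Ideal (MvPolynomial (Fin (n + 1)) K)}
    (hI : IsHomogeneousIdeal I) : IsSaturated (irrelevantTorsion I) := by
  refine ⟨isHomogeneousIdeal_irrelevantTorsion hI, ?_⟩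
  rintro f ⟨t, ht⟩
  -- The exponent that works for `f * p` depends on `p`; finitely many generators of `𝔐 ^ t` make it
  -- uniform.
  obtain ⟨s, hs⟩ := (inferInstance : IsNoetherianRing (MvPolynomial (Fin (n + 1)) K)).noetherian
    (irrelevantIdeal K n ^ t)
  have key (p) (hp : p ∈ s) : ∃ T : ℕ, ∀ q ∈ irrelevantIdeal K n ^ T, f * p * q ∈ I :=
    ht p (hs ▸ Submodule.subset_span hp)
  choose! T hT using key
  refine ⟨t + s.sup T, fun x hx => ?_⟩
  rw [pow_add] at hx
  refine Submodule.mul_induction_on hx (fun p hp q hq => ?_) fun x y hx hy => ?_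
  · rw [← hs] at hp
    rw [← mul_assoc]
    induction hp using Submodule.span_induction with
    | mem p hp => exact hT p hp q (Ideal.pow_le_pow_right (Finset.le_sup hp) hq)
    | zero => simp
    | add a b _ _ ha hb =>
      rw [mul_add, add_mul]
      exact I.add_mem ha hb
    | smul c a _ ha =>
      rw [smul_eq_mul, mul_left_comm, mul_assoc]
      exact I.mul_mem_left c ha
  · rw [mul_add]
    exact I.add_mem hx hy

theorem saturation_eq_irrelevantTorsion {I : Ideal (MvPolynomial (Fin (n + 1)) K)}
    (hI : IsHomogeneousIdeal I) : saturation I = irrelevantTorsion I := by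
  refine le_antisymm (sInf_le ⟨isSaturated_irrelevantTorsion hI, le_irrelevantTorsion I⟩)
    (le_sInf ?_)
  rintro J ⟨hJ, hIJ⟩ f ⟨t, ht⟩
  exact hJ.2 f ⟨t, fun p hp => hIJ (ht p hp)⟩

/-- Equal members would give equal vectors of one basis. This ensures that removing the value `g r`
removes only the index `r`. -/
theorem IsStandardBasis.injective {I : Ideal (MvPolynomial (Fin (n + 1)) K)} {t : ℕ}
    {g : Fin t → MvPolynomial (Fin (n + 1)) K} (hg : IsStandardBasis I g) :
    Function.Injective g := by
  intro i j hij
  obtain ⟨b, hb⟩ := hg.basis (g j).totalDegree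
  obtain ⟨_, h₁⟩ := hb ⟨i, by rw [hij]⟩
  obtain ⟨_, h₂⟩ := hb ⟨j, rfl⟩
  have : b ⟨i, by rw [hij]⟩ = b ⟨j, rfl⟩ := by
    rw [h₁, h₂]
    congr 2
  exact congrArg Subtype.val (b.injective this)

/-- The column ideal is the colon ideal of the span of the other members by `g r`. -/
theorem IsHilbertBurchMatrix.mem_columnIdeal_iff {m : ℕ}
    {g : Fin (m + 1) → MvPolynomial (Fin (n + 1)) K}
    {A : Matrix (Fin m) (Fin (m + 1)) (MvPolynomial (Fin (n + 1)) K)}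
    (hA : IsHilbertBurchMatrix g A) (hg : Function.Injective g) (r : Fin (m + 1))
    (p : MvPolynomial (Fin (n + 1)) K) :
    p ∈ columnIdeal A r ↔ g r * p ∈ Ideal.span (Set.range g \ {g r}) := by
  -- The column entries are the `r`-th coordinates of the rows, so they generate the projection of
  -- the whole syzygy module.
  have hmap : columnIdeal A r = (LinearMap.ker (Fintype.linearCombination
      (MvPolynomial (Fin (n + 1)) K) g)).map (LinearMap.proj r) := by
    rw [← hA.span_eq, Submodule.map_span, ← Set.range_comp]
    rfl
  have hset : Set.range g \ {g r} = Set.range fun j => g (r.succAbove j) := by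
    rw [← Set.image_univ, ← Set.image_singleton, ← Set.image_sdiff hg, ← Set.compl_eq_univ_sdiff,
      ← Fin.range_succAbove, ← Set.range_comp]
    rfl
  rw [hmap, hset, Submodule.mem_map, Ideal.span, Submodule.mem_span_range_iff_exists_fun]
  constructor
  · rintro ⟨c, hc, rfl⟩
    rw [LinearMap.mem_ker, Fintype.linearCombination_apply, Fin.sum_univ_succAbove _ r] at hc
    refine ⟨fun j => -c (r.succAbove j), ?_⟩
    simp only [neg_smul, Finset.sum_neg_distrib]
    rw [neg_eq_of_add_eq_zero_left hc, smul_eq_mul, mul_comm, LinearMap.proj_apply]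
  · rintro ⟨c, hc⟩
    -- The relation `∑ c_j g_j = p * g r` over `j ≠ r`, read as a syzygy with `r`-th entry `p`.
    refine ⟨r.insertNth p fun j => -c j, ?_, by simp⟩
    rw [LinearMap.mem_ker, Fintype.linearCombination_apply, Fin.sum_univ_succAbove _ r]
    simp only [Fin.insertNth_apply_same, Fin.insertNth_apply_succAbove, neg_smul,
      Finset.sum_neg_distrib]
    rw [hc, smul_eq_mul, mul_comm, add_neg_cancel]

theorem IsStandardBasis.isHomogeneousIdeal_span_diff
    {I : Ideal (MvPolynomial (Fin (n + 1)) K)} {t : ℕ}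
    {g : Fin t → MvPolynomial (Fin (n + 1)) K} (hg : IsStandardBasis I g) (r : Fin t) :
    IsHomogeneousIdeal (Ideal.span (Set.range g \ {g r})) := by
  refine Ideal.homogeneous_span _ _ ?_
  rintro _ ⟨⟨j, rfl⟩, _⟩
  exact ⟨_, hg.isForm j⟩

end HilbertBurch

theorem proposition2p9 {K : Type*} [Field K] [IsAlgClosed K] {n m : ℕ}
    (I : Ideal (MvPolynomial (Fin (n + 1)) K)) (hI : HilbertBurch.IsHomogeneousIdeal I)
    (hperfect : HilbertBurch.IsPerfect I) (hheight : I.height = 2)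
    (g : Fin (m + 1) → MvPolynomial (Fin (n + 1)) K) (hg : HilbertBurch.IsStandardBasis I g)
    (A : Matrix (Fin m) (Fin (m + 1)) (MvPolynomial (Fin (n + 1)) K))
    (hA : HilbertBurch.IsHilbertBurchMatrix g A) (r : Fin (m + 1)) :
    HilbertBurch.IsInessential g r ↔
      ∃ t : ℕ, HilbertBurch.irrelevantIdeal K n ^ t ≤ HilbertBurch.columnIdeal A r := by
  rw [HilbertBurch.IsInessential,
    HilbertBurch.saturation_eq_irrelevantTorsion (hg.isHomogeneousIdeal_span_diff r),
    HilbertBurch.mem_irrelevantTorsion]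
  simp only [SetLike.le_def, hA.mem_columnIdeal_iff hg.injective r]
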